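/- Cyclically branched covers. Let $n\ge 1$ and $d\ge 2$, let $p_1,\dots,p_n$ be distinct points of the sphere $S^2$ and $q$ another point, and let $\gamma_1,\dots,\gamma_n$ be simple arcs in $S^2$ such that $\gamma_i$ runs from $q$ to $p_i$ and any two of the arcs meet only at $q$. Let $d_1,\dots,d_n\in\{1,\dots,d-1\}$ satisfy $\sum_i d_i\equiv 0 \pmod d$. Cut $S^2$ open along the arcs (this gives a $2n$-gon with sides the left and right sides of the $\gamma_i$), take $d$ copies $Y_j$, $j\in\mathbb Z/d$, of the result, and glue, for all $i$ and $j$, the left side of $\gamma_i$ on $Y_j$ to the right side of $\gamma_i$ on $Y_{j+d_i}$. A space $X$ with a map $\pi:X\to S^2$ obtained in this way, up to homeomorphism of $X$, is called a $d$-fold cyclically branched cover over an $n$-punctured sphere with branching indices $(d_1,\dots,d_n)$. It has genus $g$ if $X$ is homeomorphic to the closed connected orientable surface of genus $g$. Two such covers $\pi:X\to S^2$, $\pi':X'\to S^2$ are equivalent if there are homeomorphisms $\Psi:X\to X'$ and $\psi:S^2\to S^2$ with $\pi'\circ\Psi=\psi\circ\pi$. Theorem. Let $n\ge 3$ and $g\ge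 2$. Up to equivalence there are only finitely many cyclically branched covers of genus $g$ over an $n$-punctured sphere; indeed only finitely many tuples $(d;d_1,\dots,d_n)$ occur as degree and branching indices of such covers, and covers with equal degree and branching indices fall into finitely many equivalence classes. Moreover, the degree $d$ of every such cover satisfies $$d\le 84(g-1)\quad\text{if } n=3,\qquad d\le 12(g-1)\quad\text{if } n=4,$$ $$\frac{2g}{n-2}+1\le d\le \frac{4(g-1)}{n-4}\quad\text{if } n\ge 5.$$ -/

import Mathlib

universe u

namespace CyclicCover

/-- The round 2-sphere. -/
abbrev S2 : Type := Metric.sphere (0 : EuclideanSpace ℝ (Fin 3)) 1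

/-- The closed unit disc, used as a closed polygon whose sides are arcs of the unit circle. -/
abbrev Disc : Type := Metric.closedBall (0 : ℂ) 1

/-- The boundary point of the disc at the fraction `s` of a full counterclockwise turn. -/
noncomputable def bdry (s : ℝ) : Disc :=
  ⟨(Circle.exp (2 * Real.pi * s) : ℂ), by
    rw [mem_closedBall_zero_iff, Circle.norm_coe]⟩

/-! ### Closed orientable surfaces and the genus -/

/-- The side pairing of the `4g`-gon with boundary word `∏ a_k b_k a_k⁻¹ b_k⁻¹`;
the sides are numbered counterclockwise, and those of the `k`-th commutator
are `4k`, `4k+1`, `4k+2`, `4k+3`. -/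
inductive CommutatorRel (g : ℕ) : Disc → Disc → Prop
  | a (k : Fin g) (t : unitInterval) :
      CommutatorRel g (bdry ((4 * ((k : ℕ) : ℝ) + t) / (4 * g)))
        (bdry ((4 * ((k : ℕ) : ℝ) + 3 - t) / (4 * g)))
  | b (k : Fin g) (t : unitInterval) :
      CommutatorRel g (bdry ((4 * ((k : ℕ) : ℝ) + 1 + t) / (4 * g)))
        (bdry ((4 * ((k : ℕ) : ℝ) + 4 - t) / (4 * g)))

/-- The `4g`-gon with its sides glued in pairs: for `1 ≤ g`, the standard closed connected
orientable surface of genus `g`. -/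
def PolygonSurface (g : ℕ) : Type := Quot (CommutatorRel g)

instance (g : ℕ) : TopologicalSpace (PolygonSurface g) :=
  inferInstanceAs (TopologicalSpace (Quot (CommutatorRel g)))

/-- `X` is a closed connected orientable surface of genus `g`: it is homeomorphic to the standard
one (the sphere if `g = 0`). -/
def HasGenus (X : Type*) [TopologicalSpace X] : ℕ → Prop
  | 0 => Nonempty (X ≃ₜ S2)
  | g + 1 => Nonempty (X ≃ₜ PolygonSurface (g + 1))

/-! ### The sphere cut open along branch cuts

Cutting the sphere along `n` arcs `γ 0, …, γ (n-1)` that run from a common point `q` to `n` distinct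
points `p i` gives a `2n`-gon. Counterclockwise, its boundary runs along the left side of
`γ 0` from `q` to `p 0`, back along the right side of `γ 0` from `p 0` to `q`, then along
the left side of `γ 1`, and so on. -/

/-- The point of parameter `t` on the left side of the `i`-th cut. -/
noncomputable def leftSide (n : ℕ) (i : Fin n) (t : unitInterval) : Disc :=
  bdry ((2 * ((i : ℕ) : ℝ) + t) / (2 * n))

/-- The point of parameter `t` on the right side of the `i`-th cut. -/
noncomputable def rightSide (n : ℕ) (i : Fin n) (t : unitInterval) : Disc :=
  bdry ((2 * ((i : ℕ) : ℝ) + 2 - t) / (2 * n))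

/-- An `n`-punctured sphere with a base point, a system of branch cuts and the resulting
identification `unfold` of the sphere cut open along them with a `2n`-gon. -/
structure CutSphere (n : ℕ) where
  /-- the punctures -/
  p : Fin n → S2
  /-- the base point -/
  q : S2
  /-- the branch cuts -/
  γ : Fin n → C(unitInterval, S2)
  p_injective : Function.Injective p
  q_ne_p : ∀ i, q ≠ p i
  γ_zero : ∀ i, γ i 0 = q
  γ_one : ∀ i, γ i 1 = p i
  γ_injective : ∀ i, Function.Injective (γ i)
  /-- distinct cuts meet in the base point only -/
  γ_disjoint : ∀ i k s t, i ≠ k → γ i s = γ k t → s = 0 ∧ t = 0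
  /-- the map from the cut-open sphere to the sphere -/
  unfold : C(Disc, S2)
  unfold_left : ∀ i t, unfold (leftSide n i t) = γ i t
  unfold_right : ∀ i t, unfold (rightSide n i t) = γ i t
  unfold_injOn : Set.InjOn unfold {z : Disc | ‖(z : ℂ)‖ < 1}
  unfold_image : unfold '' {z : Disc | ‖(z : ℂ)‖ < 1} = (⋃ i, Set.range (γ i))ᶜ

/-! ### Cyclically branched covers -/

/-- The gluing of the `d` sheets, indexed by `ZMod d`: the left side of the `i`-th cut on the `j`-th
sheet is glued to the right side of the `i`-th cut on the sheet `j + δ i`. -/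
inductive SheetRel (n d : ℕ) (δ : Fin n → ℕ) :
    (Σ _ : ZMod d, Disc) → (Σ _ : ZMod d, Disc) → Prop
  | glue (j : ZMod d) (i : Fin n) (t : unitInterval) :
      SheetRel n d δ ⟨j, leftSide n i t⟩ ⟨j + (δ i : ZMod d), rightSide n i t⟩

/-- The space obtained from `d` copies of the cut-open sphere by gluing with
branching indices `δ`. -/
def GluedSheets (n d : ℕ) (δ : Fin n → ℕ) : Type := Quot (SheetRel n d δ)

instance (n d : ℕ) (δ : Fin n → ℕ) : TopologicalSpace (GluedSheets n d δ) :=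
  inferInstanceAs (TopologicalSpace (Quot (SheetRel n d δ)))

/-- The map `π` from `X` to the sphere is a `d`-fold cyclically branched cover over an `n`-punctured
sphere with branching indices `δ`: the indices lie in `{1, …, d - 1}`, their sum is `0` modulo `d`
(there is no branching over the base point), and, for some choice of the punctures,
of the base point and of the branch cuts, `X` is the result of gluing `d` sheets
and `π` is the projection of the sheets. Connectedness of `X` is not part of this
definition. -/
structure IsCyclicallyBranchedCover (n d : ℕ) (δ : Fin n → ℕ)
    {X : Type*} [TopologicalSpace X] (π : X → S2) : Prop where
  index_pos : ∀ i, 1 ≤ δ i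
  index_lt : ∀ i, δ i < d
  dvd_sum : d ∣ ∑ i, δ i
  exists_gluing : ∃ (Y : CutSphere n) (Φ : GluedSheets n d δ ≃ₜ X),
    ∀ (j : ZMod d) (z : Disc), π (Φ (Quot.mk _ ⟨j, z⟩)) = Y.unfold z

/-- A cyclically branched cover over an `n`-punctured sphere. -/
structure Cover (n : ℕ) where
  /-- the covering surface -/
  X : Type u
  /-- its topology -/
  [top : TopologicalSpace X]
  /-- the covering map -/
  π : X → S2
  /-- the degree -/
  d : ℕ
  /-- the branching indices -/
  δ : Fin n → ℕ
  isCover : IsCyclicallyBranchedCover n d δ π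

attribute [instance] Cover.top

/-- Topological equivalence of covers: a homeomorphism of the covering surfaces that lies over a
homeomorphism of the spheres. -/
def Cover.Equivalent {n : ℕ} (C C' : Cover n) : Prop :=
  ∃ (Ψ : C.X ≃ₜ C'.X) (ψ : S2 ≃ₜ S2), ∀ x, C'.π (Ψ x) = ψ (C.π x)

end CyclicCover

/-! Everything rests on the Riemann-Hurwitz formula 2g - 2 = d(n - 2) - ∑ gcd(d, δ i), where gcd(d,
δ i) is the number of points over the i-th puncture (`riemann_hurwitz`). With e i = d / gcd(d, δ i)
≥ 2 it reads 2g - 2 = d(n - 2 - ∑ 1/e i), and the bounds on d are elementary estimates of ∑ 1/e i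
(`degree_bounds`). Bounded d leaves finitely many indices δ i < d.

The formula is proved by computing the rank of H¹(X; ℤ), taken as maps to ℝ/ℤ modulo those that lift
to ℝ, in two ways. If X is glued from discs, a map to the circle lifts over each disc; the lifts
differ by a constant integer along each glued arc, and they are unique up to an integer on each
disc. So H¹ is the group of realizable jumps modulo coboundaries
(`Gluing.finrank_circleCohomology`). The 4g-gon gives rank 2g, since all jumps are realizable and
coboundaries vanish. For the glued sheets a family of jumps is realizable exactly when consistent
integer corner values exist; this is linear algebra over functions ZMod d → ℤ (`map_jumps_sheets`,
`finrank_closedJumps`). Connectedness of X enters as the statement that the δ i generate ZMod d.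

Covers with the same d and δ are in fact all equivalent: the points of the 2n-gon that are
identified in the sphere do not depend on the cuts, so any two cut spheres correspond by a
homeomorphism, which lifts sheet by sheet. -/

namespace CyclicCover

open Module

/-! ### Shifts of integer-valued functions on a finite abelian group -/

theorem finrank_ker_add_finrank_range {M N : Type*} [AddCommGroup M] [AddCommGroup N]
    [Module.Finite ℤ M] (f : M →ₗ[ℤ] N) :
    finrank ℤ (LinearMap.ker f) + finrank ℤ (LinearMap.range f) = finrank ℤ M := by
  rw [← f.quotKerEquivRange.finrank_eq, add_comm]
  exact Submodule.finrank_quotient_add_finrank _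

theorem finrank_map_add_finrank_ker {M N : Type*} [AddCommGroup M] [AddCommGroup N]
    [Module.Finite ℤ M] (f : M →ₗ[ℤ] N) (K : Submodule ℤ M) (h : LinearMap.ker f ≤ K) :
    finrank ℤ (K.map f) + finrank ℤ (LinearMap.ker f) = finrank ℤ K := by
  have h1 := finrank_ker_add_finrank_range (f.domRestrict K)
  rw [LinearMap.range_domRestrict, LinearMap.ker_domRestrict,
    (Submodule.comapSubtypeEquivOfLe h).finrank_eq] at h1
  omega

section Shift

variable {G : Type*} [AddCommGroup G]

/-- Translation of functions by `a`. -/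
def shift (a : G) : (G → ℤ) →ₗ[ℤ] (G → ℤ) := LinearMap.funLeft ℤ ℤ (· + a)

@[simp] theorem shift_apply (a : G) (v : G → ℤ) (x : G) : shift a v x = v (x + a) := rfl

theorem shift_shift (a b : G) (v : G → ℤ) : shift a (shift b v) = shift (a + b) v := by
  ext x; simp [add_assoc]

@[simp] theorem shift_zero (v : G → ℤ) : shift (0 : G) v = v := by ext x; simp

/-- The functions which are invariant under the translations by the elements of `S`. -/
def invariants (S : Set G) : Submodule ℤ (G → ℤ) where
  carrier := {v | ∀ a ∈ S, ∀ x, v (x + a) = v x}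
  add_mem' hv hw a ha x := by simp [hv a ha x, hw a ha x]
  zero_mem' a _ x := rfl
  smul_mem' c v hv a ha x := by simp [hv a ha x]

theorem mem_invariants_closure {S : Set G} {v : G → ℤ} (hv : v ∈ invariants S) {a : G}
    (ha : a ∈ AddSubgroup.closure S) (x : G) : v (x + a) = v x := by
  induction ha using AddSubgroup.closure_induction generalizing x with
  | mem a ha => exact hv a ha x
  | zero => simp
  | add a b _ _ iha ihb => rw [← add_assoc, ihb, iha]
  | neg a _ iha => rw [← iha (x + -a)]; simp

/-- Invariant functions are functions on the quotient. -/
noncomputable def invariantsEquiv (S : Set G) :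
    (G ⧸ AddSubgroup.closure S → ℤ) ≃ₗ[ℤ] invariants S :=
  LinearEquiv.ofBijective
    ((LinearMap.funLeft ℤ ℤ (QuotientAddGroup.mk (s := AddSubgroup.closure S))).codRestrict
      (invariants S) fun v a ha x => congrArg v (by
        rw [QuotientAddGroup.mk_add_of_mem]
        exact AddSubgroup.subset_closure ha)) (by
    constructor
    · intro v w h
      funext y
      obtain ⟨x, rfl⟩ := QuotientAddGroup.mk_surjective y
      exact congrFun (congrArg Subtype.val h) x
    · rintro ⟨v, hv⟩
      refine ⟨fun y => Quotient.liftOn' y v fun x y hxy => ?_, ?_⟩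
      · rw [← mem_invariants_closure hv (QuotientAddGroup.leftRel_apply.1 hxy) x]
        simp
      · ext x; rfl)

theorem finrank_invariants [Finite G] (S : Set G) :
    finrank ℤ (invariants S) = (AddSubgroup.closure S).index := by
  have := Fintype.ofFinite (G ⧸ AddSubgroup.closure S)
  rw [← (invariantsEquiv S).finrank_eq, finrank_fintype_fun_eq_card, AddSubgroup.index,
    Nat.card_eq_fintype_card]

end Shift

/-! ### Linear algebra of jumps across the cuts -/

section CyclicSystem

variable {G : Type*} [AddCommGroup G] {n : ℕ} (δ : Fin n → G)

/-- The partial sums of `δ`. -/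
def partialSum (k : ℕ) : G := ∑ i ∈ Finset.univ.filter fun i : Fin n => (i : ℕ) < k, δ i

theorem filter_lt_succ (i : Fin n) :
    (Finset.univ.filter fun l : Fin n => (l : ℕ) < (i : ℕ) + 1) =
      insert i (Finset.univ.filter fun l : Fin n => (l : ℕ) < i) := by
  ext l; simp [Fin.ext_iff]; omega

theorem partialSum_succ (i : Fin n) : partialSum δ (i + 1) = partialSum δ i + δ i := by
  rw [partialSum, filter_lt_succ, Finset.sum_insert (by simp), add_comm, partialSum]

theorem partialSum_top : partialSum δ n = ∑ i, δ i := by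
  simp [partialSum]

/-- The map `(v i) ↦ (v i - shift (δ i) (v i))`. -/
def diffMap : (Fin n → G → ℤ) →ₗ[ℤ] (Fin n → G → ℤ) where
  toFun v i := v i - shift (δ i) (v i)
  map_add' v w := by ext; simp; ring
  map_smul' c v := by ext; simp; ring

@[simp] theorem diffMap_apply (v : Fin n → G → ℤ) (i : Fin n) :
    diffMap δ v i = v i - shift (δ i) (v i) := rfl

/-- The total change along a path which crosses all cuts in succession. -/
def totalMap : (Fin n → G → ℤ) →ₗ[ℤ] (G → ℤ) :=
  ∑ i : Fin n, shift (partialSum δ (i : ℕ)) ∘ₗ LinearMap.proj i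

theorem totalMap_apply (m : Fin n → G → ℤ) :
    totalMap δ m = ∑ i : Fin n, shift (partialSum δ i) (m i) := by
  simp [totalMap]

/-- The families of jumps without monodromy around the vertices. -/
def closedJumps : Submodule ℤ (Fin n → G → ℤ) :=
  (LinearMap.ker (totalMap δ ∘ₗ diffMap δ)).map (diffMap δ)

variable {δ}

/-- Here `v i` stands for the corner values at the tip of the `i`-th cut and `w k` for those at the
corners over the base point. The recursion for `w` telescopes after shifting by partial sums, so
going once around the polygon leaves the single condition `totalMap δ m = 0`. -/
theorem mem_closedJumps_iff (h0 : ∑ i, δ i = 0) (m : Fin n → G → ℤ) :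
    m ∈ closedJumps δ ↔ ∃ (v : Fin n → G → ℤ) (w : ℕ → G → ℤ), w n = w 0 ∧
      (∀ i x, m i x = v i x - v i (x + δ i)) ∧
      ∀ (i : Fin n) x, m i x = w i x - w (i + 1) (x + δ i) := by
  constructor
  · rintro ⟨v, hv, rfl⟩
    set m := diffMap δ v with hm
    have hv' : totalMap δ m = 0 := hv
    rw [totalMap_apply] at hv'
    -- The recursion solved with `w 0 = 0`; the kernel condition says that `w n` vanishes too.
    refine ⟨v, fun k => -shift (-partialSum δ k)
      (∑ l ∈ Finset.univ.filter fun l : Fin n => (l : ℕ) < k, shift (partialSum δ l) (m l)), ?_, fun i x => rfl, ?_⟩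
    · simp [hv']
    · intro i x
      have : shift (δ i) (-shift (-partialSum δ (i + 1))
          (∑ l ∈ Finset.univ.filter fun l : Fin n => (l : ℕ) < (i : ℕ) + 1, shift (partialSum δ l) (m l))) =
          -shift (-partialSum δ i)
          (∑ l ∈ Finset.univ.filter fun l : Fin n => (l : ℕ) < (i : ℕ), shift (partialSum δ l) (m l)) - m i := by
        rw [filter_lt_succ, Finset.sum_insert (by simp), map_neg, shift_shift, partialSum_succ,
          show δ i + -(partialSum δ i + δ i) = -partialSum δ i by abel, map_add, shift_shift]
        simp; abel
      have := congrFun this x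
      rw [shift_apply, Pi.sub_apply] at this
      dsimp only
      rw [this]; ring
  · rintro ⟨v, w, hw, hv, hm⟩
    have hmv : m = diffMap δ v := by ext i x; simp [hv i x]
    refine ⟨v, ?_, hmv.symm⟩
    change totalMap δ (diffMap δ v) = 0
    rw [← hmv, totalMap_apply]
    have : ∀ i : Fin n, shift (partialSum δ i) (m i) =
        (fun k : ℕ => shift (partialSum δ k) (w k) - shift (partialSum δ (k + 1)) (w (k + 1))) i := by
      intro i
      ext x
      simp [hm i, partialSum_succ, add_assoc]
    rw [Finset.sum_congr rfl fun i _ => this i, Fin.sum_univ_eq_sum_range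
      (fun k : ℕ => shift (partialSum δ k) (w k) - shift (partialSum δ (k + 1)) (w (k + 1))),
      Finset.sum_range_sub', partialSum_top, h0, hw]
    simp [partialSum]

/-- The sum of the values of a function. -/
def sumMap (G : Type*) [Fintype G] : (G → ℤ) →ₗ[ℤ] ℤ := ∑ x, LinearMap.proj x

theorem sumMap_apply {H : Type*} [Fintype H] (v : H → ℤ) : sumMap H v = ∑ x, v x := by
  simp [sumMap]

theorem sumMap_shift [Fintype G] (a : G) (v : G → ℤ) : sumMap G (shift a v) = sumMap G v := by
  simp only [sumMap_apply, shift_apply]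
  exact Fintype.sum_equiv (Equiv.addRight a) _ _ fun _ => rfl

theorem finrank_ker_sumMap [Fintype G] :
    finrank ℤ (LinearMap.ker (sumMap G)) + 1 = Fintype.card G := by
  classical
  have h := finrank_ker_add_finrank_range (sumMap G)
  rw [LinearMap.range_eq_top.2, finrank_top, finrank_self, finrank_fintype_fun_eq_card] at h
  · exact h
  · intro k
    exact ⟨Pi.single 0 k, by simp [sumMap_apply]⟩

/-- Shifts preserve sums, which gives one inclusion. For the other, the set of `a` with all `v -
shift a v` in the range is a subgroup containing every `δ i`, hence everything, and functions of sum
zero are combinations of differences of point masses. -/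
theorem range_totalMap_diffMap [Fintype G] (hδ : AddSubgroup.closure (Set.range δ) = ⊤) :
    LinearMap.range (totalMap δ ∘ₗ diffMap δ) = LinearMap.ker (sumMap G) := by
  classical
  apply le_antisymm
  · rintro _ ⟨v, rfl⟩
    rw [LinearMap.mem_ker, LinearMap.comp_apply, totalMap_apply, map_sum]
    exact Finset.sum_eq_zero fun i _ => by rw [sumMap_shift, diffMap_apply, map_sub, sumMap_shift,
      sub_self]
  · set R := LinearMap.range (totalMap δ ∘ₗ diffMap δ)
    have key : ∀ a : G, ∀ v, v - shift a v ∈ R := by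
      intro a
      have ha : a ∈ AddSubgroup.closure (Set.range δ) := hδ ▸ AddSubgroup.mem_top a
      induction ha using AddSubgroup.closure_induction with
      | mem a ha =>
        obtain ⟨i, rfl⟩ := ha
        intro v
        refine ⟨Pi.single i (shift (-partialSum δ i) v), ?_⟩
        rw [LinearMap.comp_apply, totalMap_apply, Finset.sum_eq_single i]
        · simp [shift_shift]
        · intro k _ hk
          simp [hk]
        · simp
      | zero => intro v; simp
      | add a b _ _ iha ihb =>
        intro v
        have := R.add_mem (iha v) (ihb (shift a v))
        rwa [shift_shift, sub_add_sub_cancel, add_comm b] at this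
      | neg a _ iha =>
        intro v
        have := R.neg_mem (iha (shift (-a) v))
        rwa [shift_shift, add_neg_cancel, shift_zero, neg_sub] at this
    intro v hv
    rw [LinearMap.mem_ker, sumMap_apply] at hv
    -- Shifting by `x` moves the point mass at `x` to `0`; the masses collected at `0` cancel
    -- because the sum of `v` is zero.
    have : v = ∑ x, v x • ((Pi.single x 1 : G → ℤ) - shift x (Pi.single x 1)) := by
      ext y
      simp only [Finset.sum_apply, Pi.smul_apply, Pi.sub_apply, shift_apply, smul_eq_mul, mul_sub,
        Finset.sum_sub_distrib, Pi.single_apply, add_eq_right]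
      rw [← Finset.sum_mul, hv]
      simp
    rw [this]
    exact R.sum_mem fun x _ => R.smul_mem _ (key x _)

/-- The kernel is a product over `i`: the `i`-th component is a function on the cosets of the
subgroup generated by `δ i`, that is, on the points over the `i`-th puncture. -/
theorem finrank_ker_diffMap [Finite G] :
    finrank ℤ (LinearMap.ker (diffMap δ)) = ∑ i, (AddSubgroup.closure {δ i}).index := by
  have e : LinearMap.ker (diffMap δ) = Submodule.pi Set.univ fun i => invariants {δ i} := by
    ext v
    simp only [LinearMap.mem_ker, Submodule.mem_pi, Set.mem_univ, forall_const]
    constructor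
    · rintro h i a rfl x
      have := congrFun (congrFun h i) x
      simp only [diffMap_apply, Pi.sub_apply, shift_apply, Pi.zero_apply] at this
      omega
    · intro h
      ext i x
      simp [h i (δ i) rfl x]
  let f : (∀ i, invariants {δ i}) ≃ₗ[ℤ] LinearMap.ker (diffMap δ) :=
    { toFun := fun v => ⟨fun i => v i, by rw [e]; exact fun i _ => (v i).2⟩
      invFun := fun v i => ⟨v.1 i, (e.le v.2 : _) i trivial⟩
      map_add' := fun _ _ => rfl
      map_smul' := fun _ _ => rfl
      left_inv := fun _ => rfl
      right_inv := fun _ => rfl }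
  have (i : Fin n) : Module.Free ℤ (invariants {δ i}) := .of_equiv (invariantsEquiv {δ i})
  have (i : Fin n) : Module.Finite ℤ (invariants {δ i}) := .equiv (invariantsEquiv {δ i})
  rw [← f.finrank_eq, finrank_pi_fintype]
  exact Finset.sum_congr rfl fun i _ => finrank_invariants _

theorem finrank_closedJumps [Fintype G] (hδ : AddSubgroup.closure (Set.range δ) = ⊤) :
    finrank ℤ (closedJumps δ) + ∑ i, (AddSubgroup.closure {δ i}).index + Fintype.card G =
      n * Fintype.card G + 1 := by
  have h1 := finrank_map_add_finrank_ker (diffMap δ) (LinearMap.ker (totalMap δ ∘ₗ diffMap δ))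
    (LinearMap.ker_le_ker_comp _ _)
  have h2 := finrank_ker_add_finrank_range (totalMap δ ∘ₗ diffMap δ)
  have h3 := finrank_ker_sumMap (G := G)
  rw [range_totalMap_diffMap hδ] at h2
  rw [finrank_ker_diffMap] at h1
  have h4 : finrank ℤ (Fin n → G → ℤ) = n * Fintype.card G := by
    simp [finrank_pi_fintype]
  rw [closedJumps]
  omega

/-- The jumps of a function which is constant on every sheet. -/
def sheetCoboundary (δ : Fin n → G) : (G → ℤ) →ₗ[ℤ] (Fin n → G → ℤ) :=
  diffMap δ ∘ₗ LinearMap.pi fun _ => LinearMap.id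

/-- Since the `δ i` generate, only the constants have no jumps. -/
theorem finrank_range_sheetCoboundary [Fintype G]
    (hδ : AddSubgroup.closure (Set.range δ) = ⊤) :
    finrank ℤ (LinearMap.range (sheetCoboundary δ)) + 1 = Fintype.card G := by
  have h := finrank_ker_add_finrank_range (sheetCoboundary δ)
  have e : LinearMap.ker (sheetCoboundary δ) = invariants (Set.range δ) := by
    ext v
    rw [LinearMap.mem_ker]
    constructor
    · rintro h _ ⟨i, rfl⟩ x
      have := congrFun (congrFun h i) x
      simp only [sheetCoboundary, LinearMap.comp_apply, diffMap_apply, LinearMap.pi_apply,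
        LinearMap.id_apply, Pi.sub_apply, shift_apply, Pi.zero_apply] at this
      omega
    · intro h
      ext i x
      simp [sheetCoboundary, h (δ i) ⟨i, rfl⟩ x]
  rw [e, finrank_invariants, hδ, AddSubgroup.index_top, finrank_fintype_fun_eq_card] at h
  omega

end CyclicSystem

theorem index_closure_singleton (d a : ℕ) [NeZero d] :
    (AddSubgroup.closure {(a : ZMod d)}).index = d.gcd a := by
  have h := (AddSubgroup.closure {(a : ZMod d)}).card_mul_index
  rw [← AddSubgroup.zmultiples_eq_closure, Nat.card_zmultiples, Nat.card_zmod,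
    ZMod.addOrderOf_coe _ (NeZero.ne d)] at h
  rw [← AddSubgroup.zmultiples_eq_closure]
  have h2 := Nat.div_mul_cancel (Nat.gcd_dvd_left d a)
  have h3 : 0 < d / d.gcd a := Nat.div_pos (Nat.gcd_le_left _ (NeZero.pos d))
    (Nat.gcd_pos_of_pos_left _ (NeZero.pos d))
  exact Nat.eq_of_mul_eq_mul_left h3 (h.trans h2.symm)

/-! ### Bounds on the degree -/

/-- The extremal triple is (2, 3, 7). Large entries make the sum small, which leaves finitely many
triples to inspect; the cutoff 13 for `c` is generous. -/
theorem hurwitz_triple {a b c : ℕ} (ha : 2 ≤ a) (hab : a ≤ b) (hbc : b ≤ c)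
    (h : (1 : ℝ) / a + 1 / b + 1 / c < 1) : (1 : ℝ) / a + 1 / b + 1 / c ≤ 41 / 42 := by
  have inv_le : ∀ {k m : ℕ}, 0 < k → k ≤ m → (1 : ℝ) / m ≤ 1 / k := fun hk hkm =>
    one_div_le_one_div_of_le (by exact_mod_cast hk) (by exact_mod_cast hkm)
  have ha' := inv_le (by norm_num) ha
  rcases Nat.lt_or_ge a 4 with h4 | h4
  · rcases Nat.lt_or_ge b 6 with hb6 | hb6
    · rcases Nat.lt_or_ge c 13 with hc | hc
      · have hb2 : 2 ≤ b := ha.trans hab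
        have hc2 : 2 ≤ c := hb2.trans hbc
        interval_cases a <;> interval_cases b <;>
          first
          | omega
          | (interval_cases c <;> first | omega | (exfalso; norm_num at h; done) | norm_num)
      · have hc' := inv_le (by norm_num) hc
        have hb2 : 2 ≤ b := ha.trans hab
        have hc0 : (0 : ℝ) < 1 / c := by
          apply one_div_pos.2; exact_mod_cast (by omega : 0 < c)
        interval_cases a <;> interval_cases b <;> first | omega | (norm_num at h hc' hc0 ⊢; linarith)
    · have hb' := inv_le (by norm_num) hb6
      rcases Nat.lt_or_ge b 7 with hb7 | hb7
      · obtain rfl : b = 6 := by omega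
        rcases Nat.lt_or_ge c 7 with hc7 | hc7
        · obtain rfl : c = 6 := by omega
          interval_cases a <;> norm_num at h ⊢
        · have hc' := inv_le (by norm_num) hc7
          norm_num at *; linarith
      · have hb' := inv_le (by norm_num) hb7
        have hc' := inv_le (by norm_num) (hb7.trans hbc)
        norm_num at *; linarith
  · have ha' := inv_le (by norm_num) h4
    have hb' := inv_le (by norm_num) (h4.trans hab)
    have hc' := inv_le (by norm_num) (h4.trans (hab.trans hbc))
    norm_num at *; linarith

theorem hurwitz_triple' {a b c : ℕ} (ha : 2 ≤ a) (hb : 2 ≤ b) (hc : 2 ≤ c)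
    (h : (1 : ℝ) / a + 1 / b + 1 / c < 1) : (1 : ℝ) / a + 1 / b + 1 / c ≤ 41 / 42 := by
  rcases le_total a b with h1 | h1 <;> rcases le_total b c with h2 | h2 <;>
    rcases le_total a c with h3 | h3
  · exact hurwitz_triple ha h1 h2 h
  · exact hurwitz_triple ha h1 h2 h
  · linarith [hurwitz_triple ha h3 h2 (by linarith)]
  · linarith [hurwitz_triple hc h3 h1 (by linarith)]
  · linarith [hurwitz_triple hb h1 h3 (by linarith)]
  · linarith [hurwitz_triple hb h2 h3 (by linarith)]
  · linarith [hurwitz_triple hc h2 h1 (by linarith)]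
  · linarith [hurwitz_triple hc h2 h1 (by linarith)]

/-- The bounds on the degree which follow from the Riemann-Hurwitz formula. -/
theorem degree_bounds {n g d : ℕ} {δ : Fin n → ℕ} (hn : 3 ≤ n) (hg : 2 ≤ g)
    (h1 : ∀ i, 1 ≤ δ i) (h2 : ∀ i, δ i < d)
    (hRH : 2 * g + ∑ i, d.gcd (δ i) + 2 * d = n * d + 2) :
    (n = 3 → (d : ℝ) ≤ 84 * ((g : ℝ) - 1)) ∧
    (n = 4 → (d : ℝ) ≤ 12 * ((g : ℝ) - 1)) ∧
    (5 ≤ n → 2 * (g : ℝ) / ((n : ℝ) - 2) + 1 ≤ (d : ℝ) ∧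
      (d : ℝ) ≤ 4 * ((g : ℝ) - 1) / ((n : ℝ) - 4)) := by
  have hd : 0 < d := (Nat.zero_le _).trans_lt (h2 ⟨0, by omega⟩)
  have hdR : (0 : ℝ) < d := by exact_mod_cast hd
  have hgR : (2 : ℝ) ≤ g := by exact_mod_cast hg
  -- `e i` is the ramification order over the `i`-th puncture; it is at least 2 because 0 < `δ i` <
  -- `d`.
  choose e he using fun i => Nat.gcd_dvd_left d (δ i)
  have hpos : ∀ i, 0 < d.gcd (δ i) := fun i => Nat.gcd_pos_of_pos_left _ hd
  have he2 : ∀ i, 2 ≤ e i := by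
    intro i
    have hlt : d.gcd (δ i) < d := (Nat.gcd_le_right _ (h1 i)).trans_lt (h2 i)
    by_contra hcon
    have : e i ≤ 1 := by omega
    have := Nat.mul_le_mul_left (d.gcd (δ i)) this
    rw [← he i] at this
    omega
  have hgcd : ∀ i, ((d.gcd (δ i) : ℕ) : ℝ) = d * (1 / e i) := by
    intro i
    have h0 : (e i : ℝ) ≠ 0 := by
      have := he2 i
      exact_mod_cast (by omega : e i ≠ 0)
    have : (d : ℝ) = (d.gcd (δ i) : ℕ) * e i := by exact_mod_cast he i
    rw [mul_one_div, eq_div_iff h0, ← this]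
  have hRH' : 2 * (g : ℝ) + ∑ i, ((d.gcd (δ i) : ℕ) : ℝ) + 2 * d = n * d + 2 := by
    exact_mod_cast hRH
  have hhalf : ∀ i, (1 : ℝ) / e i ≤ 1 / 2 := fun i =>
    one_div_le_one_div_of_le (by norm_num) (by exact_mod_cast he2 i)
  refine ⟨?_, ?_, ?_⟩
  · rintro rfl
    simp only [hgcd, ← Finset.mul_sum] at hRH'
    rw [Fin.sum_univ_three] at hRH'
    have hlt : (1 : ℝ) / e 0 + 1 / e 1 + 1 / e 2 < 1 := by
      by_contra hcon
      have := mul_le_mul_of_nonneg_left (not_lt.1 hcon) hdR.le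
      push_cast at hRH'
      linarith
    have := mul_le_mul_of_nonneg_left (hurwitz_triple' (he2 0) (he2 1) (he2 2) hlt) hdR.le
    push_cast at hRH'
    linarith
  · rintro rfl
    simp only [hgcd, ← Finset.mul_sum] at hRH'
    rw [Fin.sum_univ_four] at hRH'
    -- Four orders equal to 2 would force genus 1. Hence the sum of inverses is at most 3/2 + 1/3 =
    -- 11/6.
    have hex : ∃ i, 3 ≤ e i := by
      by_contra! hcon
      have : ∀ i, e i = 2 := fun i => by have := he2 i; have := hcon i; omega
      simp only [this] at hRH'
      push_cast at hRH'
      linarith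
    have hle : (1 : ℝ) / e 0 + 1 / e 1 + 1 / e 2 + 1 / e 3 ≤ 11 / 6 := by
      obtain ⟨i, hi⟩ := hex
      have : (1 : ℝ) / e i ≤ 1 / 3 :=
        one_div_le_one_div_of_le (by norm_num) (by exact_mod_cast hi)
      have h0 := hhalf 0
      have h1 := hhalf 1
      have h2 := hhalf 2
      have h3 := hhalf 3
      fin_cases i <;> simp only [Fin.zero_eta, Fin.mk_one, Fin.reduceFinMk] at this <;> linarith
    have := mul_le_mul_of_nonneg_left hle hdR.le
    push_cast at hRH'
    linarith
  · intro hn5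
    have hnR : (5 : ℝ) ≤ n := by exact_mod_cast hn5
    constructor
    -- At least one point over each puncture gives 2g ≤ (n - 2)(d - 1).
    · have : (n : ℝ) ≤ ∑ i, ((d.gcd (δ i) : ℕ) : ℝ) := by
        calc (n : ℝ) = ∑ _i : Fin n, (1 : ℝ) := by simp
          _ ≤ _ := Finset.sum_le_sum fun i _ => by exact_mod_cast hpos i
      rw [← le_sub_iff_add_le, div_le_iff₀ (by linarith)]
      linarith
    · have : ∑ i, ((d.gcd (δ i) : ℕ) : ℝ) ≤ n * (d * (1 / 2)) := by
        calc _ ≤ ∑ _i : Fin n, (d : ℝ) * (1 / 2) := Finset.sum_le_sum fun i _ => by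
              rw [hgcd]; exact mul_le_mul_of_nonneg_left (hhalf i) hdR.le
          _ = _ := by simp
      rw [le_div_iff₀ (by linarith)]
      linarith

/-! ### The first integral cohomology of a space glued from discs -/

theorem exists_int_const {Y : Type*} [TopologicalSpace Y] [PreconnectedSpace Y] {f : Y → ℝ}
    (hf : Continuous f) (h : ∀ y, ∃ k : ℤ, f y = k) : ∃ k : ℤ, ∀ y, f y = k := by
  choose k hk using h
  rcases isEmpty_or_nonempty Y with hY | ⟨⟨y₀⟩⟩
  · exact ⟨0, fun y => hY.elim y⟩
  · have hc : Continuous k := by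
      rw [Int.isClosedEmbedding_coe_real.isEmbedding.continuous_iff]
      exact hf.congr hk
    exact ⟨k y₀, fun y => by rw [hk y, PreconnectedSpace.constant ‹_› hc]⟩

theorem unitAddCircle_coe_eq_zero_iff (x : ℝ) : (x : UnitAddCircle) = 0 ↔ ∃ k : ℤ, x = k := by
  rw [AddCircle.coe_eq_zero_iff]
  exact exists_congr fun k => by simp [eq_comm]

instance : ConnectedSpace Disc :=
  isConnected_iff_connectedSpace.1
    ((convex_closedBall (0 : ℂ) 1).isConnected ⟨0, by simp⟩)

/-- Every map from the disc to the circle lifts to the line. -/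
theorem exists_disc_lift (f : C(Disc, UnitAddCircle)) :
    ∃ G : C(Disc, ℝ), ∀ z, (G z : UnitAddCircle) = f z := by
  -- Radial contraction makes `f` homotopic to a constant, which lifts; the lifted homotopy ends in
  -- a lift of `f`.
  let m : unitInterval × Disc → Disc := fun q => ⟨(q.1 : ℝ) • (q.2 : ℂ), by
    rw [mem_closedBall_zero_iff, norm_smul, Real.norm_of_nonneg q.1.2.1]
    exact mul_le_one₀ q.1.2.2 (norm_nonneg _) (mem_closedBall_zero_iff.1 q.2.2)⟩
  have hm : Continuous m := by fun_prop
  let H : C(unitInterval × Disc, UnitAddCircle) := ⟨fun q => f (m q), f.continuous.comp hm⟩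
  obtain ⟨x, hx⟩ := QuotientAddGroup.mk_surjective (f ⟨0, by simp⟩)
  have h0 : ∀ z, H (0, z) = ((ContinuousMap.const Disc x z : ℝ) : UnitAddCircle) := by
    intro z
    refine Eq.trans ?_ hx.symm
    change f (m (0, z)) = _
    congr 1
    ext
    simp [m]
  have cov := AddCircle.isCoveringMap_coe (1 : ℝ)
  refine ⟨(cov.liftHomotopy H (ContinuousMap.const Disc x) h0).comp
    ⟨fun z => ((1 : unitInterval), z), by fun_prop⟩, fun z => ?_⟩
  have := congrFun (cov.liftHomotopy_lifts H (ContinuousMap.const Disc x) h0) (1, z)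
  refine Eq.trans this ?_
  change f (m (1, z)) = _
  congr 1
  ext
  simp [m]

/-- The inclusion of the maps to the circle which lift to the line. -/
def coeCircle (X : Type*) [TopologicalSpace X] : C(X, ℝ) →ₗ[ℤ] C(X, UnitAddCircle) :=
  AddMonoidHom.toIntLinearMap
    { toFun := fun h => ⟨fun x => (h x : UnitAddCircle),
        (AddCircle.continuous_mk' 1).comp h.continuous⟩
      map_zero' := by ext; rfl
      map_add' := fun _ _ => by ext; rfl }

@[simp] theorem coeCircle_apply {X : Type*} [TopologicalSpace X] (h : C(X, ℝ)) (x : X) :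
    coeCircle X h x = (h x : UnitAddCircle) := rfl

/-- The first integral cohomology group, as the group of homotopy classes of maps to the circle. -/
abbrev CircleCohomology (X : Type*) [TopologicalSpace X] : Type _ :=
  C(X, UnitAddCircle) ⧸ LinearMap.range (coeCircle X)

/-- A presentation of `X` as a space glued from discs indexed by `F` along arcs indexed by `E`: the
arc `α e` in the disc `s e` is glued to the arc `β e` in the disc `t e`. -/
structure Gluing (X : Type*) [TopologicalSpace X] {F E : Type} (s t : E → F)
    (α β : E → unitInterval → Disc) where
  /-- the projection of the discs to `X` -/
  p : F → C(Disc, X)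
  p_glue : ∀ e r, p (s e) (α e r) = p (t e) (β e r)
  exists_desc : ∀ {Y : Type} [TopologicalSpace Y] (G : F → C(Disc, Y)),
    (∀ e r, G (s e) (α e r) = G (t e) (β e r)) → ∃ h : C(X, Y), ∀ j z, h (p j z) = G j z
  p_surjective : ∀ x, ∃ j z, p j z = x

section Gluing

variable {F E : Type} (s t : E → F) (α β : E → unitInterval → Disc)

/-- The families of integers which are the jumps along the arcs of some function. -/
def jumps : Submodule ℤ (E → ℤ) where
  carrier := {m | ∃ G : F → C(Disc, ℝ), ∀ e r, G (s e) (α e r) - G (t e) (β e r) = m e}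
  add_mem' := by
    rintro m m' ⟨G, hG⟩ ⟨G', hG'⟩
    refine ⟨G + G', fun e r => ?_⟩
    simp only [Pi.add_apply, ContinuousMap.add_apply, Int.cast_add, ← hG e r, ← hG' e r]
    ring
  zero_mem' := ⟨0, by simp⟩
  smul_mem' := by
    rintro c m ⟨G, hG⟩
    refine ⟨(c : ℝ) • G, fun e r => ?_⟩
    simp only [Pi.smul_apply, ContinuousMap.smul_apply, smul_eq_mul, Int.cast_mul, ← hG e r]
    ring

/-- The jumps of a locally constant function. -/
def coboundary : (F → ℤ) →ₗ[ℤ] (E → ℤ) where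
  toFun c e := c (s e) - c (t e)
  map_add' c c' := by ext; simp; ring
  map_smul' k c := by ext; simp; ring

theorem range_coboundary_le : LinearMap.range (coboundary s t) ≤ jumps s t α β := by
  rintro _ ⟨c, rfl⟩
  exact ⟨fun j => ContinuousMap.const Disc (c j), fun e r => by simp [coboundary]⟩

variable {s t α β} {X : Type*} [TopologicalSpace X]

/-- The maps to the circle together with lifts over the discs and with the jumps of the lifts. -/
def Gluing.lifts (P : Gluing X s t α β) :
    Submodule ℤ (C(X, UnitAddCircle) × (F → C(Disc, ℝ)) × (E → ℤ)) where
  carrier := {q | (∀ j z, q.1 (P.p j z) = (q.2.1 j z : UnitAddCircle)) ∧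
    ∀ e r, q.2.1 (s e) (α e r) - q.2.1 (t e) (β e r) = q.2.2 e}
  add_mem' := by
    rintro q q' ⟨h, hG⟩ ⟨h', hG'⟩
    refine ⟨fun j z => ?_, fun e r => ?_⟩
    · simp [h j z, h' j z]
    · simp only [Prod.snd_add, Prod.fst_add, Pi.add_apply, ContinuousMap.add_apply, Int.cast_add,
        ← hG e r, ← hG' e r]
      ring
  zero_mem' := ⟨by simp, by simp⟩
  smul_mem' := by
    rintro c q ⟨h, hG⟩
    refine ⟨fun j z => ?_, fun e r => ?_⟩
    · simp [h j z]
    · change c • q.2.1 (s e) (α e r) - c • q.2.1 (t e) (β e r) = ((c • q.2.2 e : ℤ) : ℝ)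
      rw [← smul_sub, hG e r, zsmul_eq_mul, smul_eq_mul, Int.cast_mul]

theorem Gluing.exists_mem_lifts_fst (P : Gluing X s t α β) (hα : ∀ e, Continuous (α e))
    (hβ : ∀ e, Continuous (β e)) (f : C(X, UnitAddCircle)) :
    ∃ q ∈ P.lifts, q.1 = f := by
  choose G hG using fun j => exists_disc_lift (f.comp (P.p j))
  have hm : ∀ e, ∃ k : ℤ, ∀ r, G (s e) (α e r) - G (t e) (β e r) = k := by
    intro e
    refine exists_int_const (((G _).continuous.comp (hα e)).sub ((G _).continuous.comp (hβ e)))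
      fun r => ?_
    rw [← unitAddCircle_coe_eq_zero_iff, AddCircle.coe_sub]
    rw [hG, hG, ContinuousMap.comp_apply, ContinuousMap.comp_apply, P.p_glue, sub_self]
  choose m hm using hm
  exact ⟨(f, G, m), ⟨fun j z => (hG j z).symm, hm⟩, rfl⟩

theorem Gluing.exists_mem_lifts_snd (P : Gluing X s t α β) {m : E → ℤ} (hm : m ∈ jumps s t α β) :
    ∃ q ∈ P.lifts, q.2.2 = m := by
  obtain ⟨G, hG⟩ := hm
  obtain ⟨f, hf⟩ := P.exists_desc (fun j => coeCircle Disc (G j)) fun e r => by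
    rw [coeCircle_apply, coeCircle_apply, ← sub_eq_zero, ← AddCircle.coe_sub,
      unitAddCircle_coe_eq_zero_iff]
    exact ⟨_, hG e r⟩
  exact ⟨(f, G, m), ⟨hf, hG⟩, rfl⟩

/-- A global real lift differs from the lift over each disc by a constant integer, and these
integers have the given jumps as coboundary. Conversely, subtracting such integers makes the local
lifts agree along the arcs, so they descend to `X`. -/
theorem Gluing.lifts_fst_mem_iff (P : Gluing X s t α β)
    {q : C(X, UnitAddCircle) × (F → C(Disc, ℝ)) × (E → ℤ)} (hq : q ∈ P.lifts) :
    q.1 ∈ LinearMap.range (coeCircle X) ↔ q.2.2 ∈ LinearMap.range (coboundary s t) := by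
  obtain ⟨f, G, m⟩ := q
  obtain ⟨hf, hG⟩ := hq
  dsimp only at hf hG ⊢
  constructor
  · rintro ⟨h, rfl⟩
    have hc : ∀ j, ∃ k : ℤ, ∀ z, G j z - h (P.p j z) = k := by
      intro j
      refine exists_int_const ((G j).continuous.sub (h.continuous.comp (P.p j).continuous))
        fun z => ?_
      rw [← unitAddCircle_coe_eq_zero_iff, AddCircle.coe_sub]
      rw [← hf, coeCircle_apply, sub_self]
    choose c hc using hc
    refine ⟨c, funext fun e => ?_⟩
    have h1 := hc (s e) (α e 0)
    have h2 := hc (t e) (β e 0)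
    have h3 := hG e 0
    rw [P.p_glue] at h1
    have : ((c (s e) - c (t e) : ℤ) : ℝ) = m e := by
      push_cast; linarith
    exact_mod_cast this
  · rintro ⟨c, rfl⟩
    obtain ⟨h, hh⟩ := P.exists_desc (fun j => G j - ContinuousMap.const Disc (c j : ℝ))
      fun e r => by
        have := hG e r
        simp only [coboundary, LinearMap.coe_mk, AddHom.coe_mk, Int.cast_sub] at this
        simp only [ContinuousMap.sub_apply, ContinuousMap.const_apply]
        linarith
    refine ⟨h, ContinuousMap.ext fun x => ?_⟩
    obtain ⟨j, z, rfl⟩ := P.p_surjective x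
    rw [coeCircle_apply, hf, hh, ← sub_eq_zero, ← AddCircle.coe_sub,
      unitAddCircle_coe_eq_zero_iff]
    exact ⟨-c j, by simp⟩

/-- The rank of the first cohomology group of a space glued from discs. -/
theorem Gluing.finrank_circleCohomology (P : Gluing X s t α β) [Finite E]
    (hα : ∀ e, Continuous (α e)) (hβ : ∀ e, Continuous (β e)) :
    finrank ℤ (CircleCohomology X) + finrank ℤ (LinearMap.range (coboundary s t)) =
      finrank ℤ (jumps s t α β) := by
  have := Fintype.ofFinite E
  let J := jumps s t α β
  let B : Submodule ℤ J := (LinearMap.range (coboundary s t)).comap J.subtype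
  let a : P.lifts →ₗ[ℤ] CircleCohomology X :=
    (LinearMap.range (coeCircle X)).mkQ ∘ₗ LinearMap.fst _ _ _ ∘ₗ P.lifts.subtype
  let b₀ : P.lifts →ₗ[ℤ] J :=
    (LinearMap.snd _ _ _ ∘ₗ LinearMap.snd _ _ _ ∘ₗ P.lifts.subtype).codRestrict J
      fun q => ⟨q.1.2.1, q.2.2⟩
  let b : P.lifts →ₗ[ℤ] J ⧸ B := B.mkQ ∘ₗ b₀
  have ha : Function.Surjective a := by
    intro y
    obtain ⟨f, rfl⟩ := Submodule.mkQ_surjective _ y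
    obtain ⟨q, hq, rfl⟩ := P.exists_mem_lifts_fst hα hβ f
    exact ⟨⟨q, hq⟩, rfl⟩
  have hb : Function.Surjective b := by
    intro y
    obtain ⟨⟨m, hm⟩, rfl⟩ := Submodule.mkQ_surjective _ y
    obtain ⟨q, hq, rfl⟩ := P.exists_mem_lifts_snd hm
    exact ⟨⟨q, hq⟩, rfl⟩
  -- Both cohomology and jumps modulo coboundaries are quotients of the module of lifts, and by the
  -- same kernel.
  have hker : LinearMap.ker a = LinearMap.ker b := by
    ext q
    simp only [a, b, LinearMap.mem_ker, LinearMap.comp_apply, Submodule.mkQ_apply,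
      Submodule.Quotient.mk_eq_zero]
    exact P.lifts_fst_mem_iff q.2
  have e : CircleCohomology X ≃ₗ[ℤ] J ⧸ B :=
    (a.quotKerEquivOfSurjective ha).symm ≪≫ₗ Submodule.quotEquivOfEq _ _ hker ≪≫ₗ
      b.quotKerEquivOfSurjective hb
  have hB : B ≃ₗ[ℤ] LinearMap.range (coboundary s t) :=
    Submodule.comapSubtypeEquivOfLe (range_coboundary_le s t α β)
  rw [e.finrank_eq, ← hB.finrank_eq]
  exact Submodule.finrank_quotient_add_finrank B

end Gluing

/-! ### The boundary of the disc -/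

theorem continuous_bdry : Continuous bdry := by
  unfold bdry
  fun_prop

theorem bdry_eq_iff {x y : ℝ} : bdry x = bdry y ↔ ∃ m : ℤ, x = y + m := by
  rw [bdry, bdry, Subtype.mk.injEq, Circle.coe_inj, Circle.exp_eq_exp]
  refine exists_congr fun m => ?_
  have := Real.two_pi_pos.ne'
  constructor
  · intro h
    have : 2 * Real.pi * x = 2 * Real.pi * (y + m) := by rw [h]; ring
    exact mul_left_cancel₀ ‹_› this
  · rintro rfl; ring

theorem norm_bdry (x : ℝ) : ‖(bdry x : ℂ)‖ = 1 := Circle.norm_coe _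

theorem exists_bdry_eq {z : Disc} (hz : ‖(z : ℂ)‖ = 1) : ∃ x, 0 ≤ x ∧ x < 1 ∧ bdry x = z := by
  set y := Complex.arg z / (2 * Real.pi) with hy
  refine ⟨Int.fract y, Int.fract_nonneg y, Int.fract_lt_one y, ?_⟩
  have h1 : bdry (Int.fract y) = bdry y :=
    bdry_eq_iff.2 ⟨-⌊y⌋, by rw [Int.fract]; push_cast; ring⟩
  rw [h1]
  ext
  have h2 : 2 * Real.pi * y = Complex.arg z := by
    rw [hy, mul_div_cancel₀ _ Real.two_pi_pos.ne']
  have h3 := Complex.norm_mul_exp_arg_mul_I (z : ℂ)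
  rw [hz, Complex.ofReal_one, one_mul] at h3
  change ((Circle.exp (2 * Real.pi * y) : Circle) : ℂ) = z
  rw [h2, Circle.coe_exp, h3]

theorem exists_piecewise_linear {N : ℕ} (hN : 0 < N) (c : ℕ → ℝ) :
    ∃ h : C(ℝ, ℝ), ∀ k < N, ∀ t : unitInterval,
      h ((k + t) / N) = (1 - t) * c k + t * c (k + 1) := by
  -- A sum of tent functions centred at the nodes k/N, including the last node k = N.
  refine ⟨⟨fun x => ∑ k ∈ Finset.range (N + 1), c k * max 0 (1 - |N * x - k|), by fun_prop⟩,
    fun l hl t => ?_⟩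
  have hN' : (N : ℝ) ≠ 0 := by positivity
  obtain ⟨t, h0, h1⟩ := t
  simp only [ContinuousMap.coe_mk, mul_div_cancel₀ _ hN']
  rw [← Finset.sum_subset (s₁ := {l, l + 1}), Finset.sum_pair (by omega)]
  · rw [show (l : ℝ) + t - l = t by ring, abs_of_nonneg h0, max_eq_right (by linarith),
      show (l : ℝ) + t - ((l + 1 : ℕ) : ℝ) = -(1 - t) by push_cast; ring, abs_neg,
      abs_of_nonneg (by linarith), max_eq_right (by linarith)]
    ring
  · intro k hk
    simp only [Finset.mem_insert, Finset.mem_singleton] at hk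
    rw [Finset.mem_range]; omega
  · intro k _ hk
    simp only [Finset.mem_insert, Finset.mem_singleton, not_or] at hk
    rw [max_eq_left, mul_zero]
    rcases Nat.lt_or_ge k l with h | h
    · have : (k : ℝ) + 1 ≤ l := by exact_mod_cast h
      linarith [le_abs_self ((l : ℝ) + t - k)]
    · have : (l : ℝ) + 2 ≤ k := by exact_mod_cast (by omega : l + 2 ≤ k)
      linarith [neg_abs_le ((l : ℝ) + t - k)]

/-- There is a function on the `N`-gon which takes prescribed values at the corners and is
linear on the sides. -/
theorem exists_disc_function {N : ℕ} (hN : 0 < N) (c : ℕ → ℝ) (hc : c N = c 0) :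
    ∃ G : C(Disc, ℝ), ∀ k < N, ∀ t : unitInterval,
      G (bdry ((k + t) / N)) = (1 - t) * c k + t * c (k + 1) := by
  obtain ⟨h, hh⟩ := exists_piecewise_linear hN c
  have hN' : (N : ℝ) ≠ 0 := by positivity
  have h01 : h 0 = h 1 := by
    have e0 := hh 0 hN 0
    have e1 := hh (N - 1) (by omega) 1
    rw [Nat.cast_sub (by omega : 1 ≤ N)] at e1
    simp only [Nat.cast_zero, Set.Icc.coe_zero, add_zero, zero_div, sub_zero, one_mul,
      zero_mul] at e0
    simp only [Nat.cast_one, Set.Icc.coe_one, sub_add_cancel, div_self hN', sub_self, zero_mul,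
      zero_add, one_mul, Nat.sub_add_cancel (by omega : 1 ≤ N)] at e1
    rw [e0, e1, hc]
  let C : Set Disc := {z | ‖(z : ℂ)‖ = 1}
  have hC : IsClosed C := isClosed_eq (by fun_prop) continuous_const
  let q : C(unitInterval, C) :=
    ⟨fun x => ⟨bdry x, norm_bdry x⟩, (continuous_bdry.comp continuous_subtype_val).subtype_mk _⟩
  have hq : Topology.IsQuotientMap q := by
    refine Topology.IsQuotientMap.of_surjective_continuous ?_ q.continuous
    rintro ⟨z, hz⟩
    obtain ⟨x, h0, h1, rfl⟩ := exists_bdry_eq hz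
    exact ⟨⟨x, h0, h1.le⟩, rfl⟩
  -- The unit interval covers the circle with only its endpoints identified, where `h` agrees. So
  -- `h` descends to the circle and extends over the disc by Tietze.
  have hfib : ∀ x y : unitInterval, q x = q y → h x = h y := by
    rintro ⟨x, hx0, hx1⟩ ⟨y, hy0, hy1⟩ hxy
    obtain ⟨m, hm⟩ := bdry_eq_iff.1 (congrArg Subtype.val hxy)
    dsimp only at hm ⊢
    have : -1 ≤ m ∧ m ≤ 1 := by
      constructor
      · exact_mod_cast (by linarith : (-1 : ℝ) ≤ m)
      · exact_mod_cast (by linarith : (m : ℝ) ≤ 1)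
    obtain ⟨hm1, hm2⟩ := this
    interval_cases m
    · obtain ⟨rfl, rfl⟩ : x = 0 ∧ y = 1 := by
        push_cast at hm; constructor <;> linarith
      exact h01
    · simp at hm; rw [hm]
    · obtain ⟨rfl, rfl⟩ : x = 1 ∧ y = 0 := by
        push_cast at hm; constructor <;> linarith
      exact h01.symm
  let f : C(C, ℝ) := hq.lift ⟨fun x : unitInterval => h x, by fun_prop⟩ hfib
  obtain ⟨G, hG⟩ := f.exists_extension hC.isClosedEmbedding_subtypeVal
  refine ⟨G, fun k hk t => ?_⟩
  have hkN : (k : ℝ) + 1 ≤ N := by exact_mod_cast hk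
  have hx : ((k : ℝ) + t) / N ∈ unitInterval := by
    have := t.2.1
    have := t.2.2
    constructor
    · positivity
    · rw [div_le_one (by positivity)]; linarith
  rw [← hh k hk t]
  have e1 : G (bdry ((k + t) / N)) = f (q ⟨_, hx⟩) :=
    congrArg (fun φ => φ (q ⟨_, hx⟩)) hG
  rw [e1]
  exact congrArg (fun φ => φ ⟨_, hx⟩) (hq.lift_comp ⟨fun x : unitInterval => h x, by fun_prop⟩ hfib)

/-! ### The standard surfaces -/

/-- The first arcs of the side pairs of the `4g`-gon. -/
noncomputable def polygonFst (g : ℕ) : Fin g ⊕ Fin g → unitInterval → Disc :=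
  Sum.elim (fun k t => bdry ((4 * ((k : ℕ) : ℝ) + t) / (4 * g)))
    fun k t => bdry ((4 * ((k : ℕ) : ℝ) + 1 + t) / (4 * g))

/-- The second arcs of the side pairs of the `4g`-gon. -/
noncomputable def polygonSnd (g : ℕ) : Fin g ⊕ Fin g → unitInterval → Disc :=
  Sum.elim (fun k t => bdry ((4 * ((k : ℕ) : ℝ) + 3 - t) / (4 * g)))
    fun k t => bdry ((4 * ((k : ℕ) : ℝ) + 4 - t) / (4 * g))

/-- The standard surface as a space glued from one disc. -/
def polygonGluing {X : Type*} [TopologicalSpace X] {g : ℕ} (Φ : PolygonSurface g ≃ₜ X) :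
    Gluing X (F := Unit) (fun _ => ()) (fun _ => ()) (polygonFst g) (polygonSnd g) where
  p _ := ⟨fun z => Φ (Quot.mk _ z), Φ.continuous.comp continuous_quot_mk⟩
  p_glue e r := by
    refine congrArg Φ (Quot.sound ?_)
    rcases e with k | k
    · exact .a k r
    · exact .b k r
  exists_desc G hG := by
    refine ⟨⟨fun x => Quot.lift (G ()) ?_ (Φ.symm x), ?_⟩, fun j z => ?_⟩
    · rintro _ _ (⟨k, r⟩ | ⟨k, r⟩)
      · exact hG (.inl k) r
      · exact hG (.inr k) r
    · exact (continuous_quot_lift _ (G ()).continuous).comp Φ.symm.continuous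
    · exact congrArg (Quot.lift (G ()) _) (Φ.symm_apply_apply _)
  p_surjective x := by
    obtain ⟨z, hz⟩ := Quot.exists_rep (Φ.symm x)
    exact ⟨(), z, by simp [hz]⟩

/-- Prescribed jumps along the sides of a commutator cancel in pairs, so the corner values return to
0 after each block of four sides and no condition arises. -/
theorem jumps_polygon (g : ℕ) :
    jumps (F := Unit) (fun _ => ()) (fun _ => ()) (polygonFst g) (polygonSnd g) = ⊤ := by
  rw [eq_top_iff]
  rintro m -
  rcases Nat.eq_zero_or_pos g with rfl | hg
  · exact ⟨0, fun e => e.elim (fun k => k.elim0) fun k => k.elim0⟩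
  let a : ℕ → ℝ := fun k => if h : k < g then m (.inl ⟨k, h⟩) else 0
  let b : ℕ → ℝ := fun k => if h : k < g then m (.inr ⟨k, h⟩) else 0
  -- The corner values in the `k`-th block are 0, b, b - a, -a; opposite corners of paired sides
  -- then differ by a and b respectively.
  let c : ℕ → ℝ := fun l => if l % 4 = 0 then 0 else if l % 4 = 1 then b (l / 4) else
    if l % 4 = 2 then b (l / 4) - a (l / 4) else -a (l / 4)
  have c0 : ∀ k, c (4 * k) = 0 := fun k => by simp [c]
  have c1 : ∀ k, c (4 * k + 1) = b k := fun k => by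
    simp [c, Nat.add_mod, (by omega : (4 * k + 1) / 4 = k)]
  have c2 : ∀ k, c (4 * k + 2) = b k - a k := fun k => by
    simp [c, Nat.add_mod, (by omega : (4 * k + 2) / 4 = k)]
  have c3 : ∀ k, c (4 * k + 3) = -a k := fun k => by
    simp [c, Nat.add_mod, (by omega : (4 * k + 3) / 4 = k)]
  have c4 : ∀ k, c (4 * k + 3 + 1) = 0 := fun k => c0 (k + 1)
  obtain ⟨G, hG⟩ := exists_disc_function (N := 4 * g) (by omega) c ((c0 g).trans (c0 0).symm)
  refine ⟨fun _ => G, fun e r => ?_⟩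
  have hs : ((unitInterval.symm r : unitInterval) : ℝ) = 1 - r := rfl
  rcases e with ⟨k, hk⟩ | ⟨k, hk⟩
  · have h1 := hG (4 * k) (by omega) r
    have h2 := hG (4 * k + 2) (by omega) (unitInterval.symm r)
    rw [c0, c1] at h1
    rw [c2, c3, hs] at h2
    push_cast at h1 h2
    rw [show (4 * (k : ℝ) + 2 + (1 - r)) = 4 * k + 3 - r by ring] at h2
    simp only [polygonFst, polygonSnd, Sum.elim_inl]
    rw [h1, h2]
    simp only [a, hk, dif_pos]
    ring
  · have h1 := hG (4 * k + 1) (by omega) r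
    have h2 := hG (4 * k + 3) (by omega) (unitInterval.symm r)
    rw [c1, c2] at h1
    rw [c3, c4, hs] at h2
    push_cast at h1 h2
    rw [show (4 * (k : ℝ) + 3 + (1 - r)) = 4 * k + 4 - r by ring] at h2
    simp only [polygonFst, polygonSnd, Sum.elim_inr]
    rw [h1, h2]
    simp only [b, hk, dif_pos]
    ring

theorem finrank_circleCohomology_polygon {X : Type*} [TopologicalSpace X] {g : ℕ}
    (Φ : PolygonSurface g ≃ₜ X) : finrank ℤ (CircleCohomology X) = 2 * g := by
  have h := (polygonGluing Φ).finrank_circleCohomology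
    (by
      rintro (k | k)
      · exact continuous_bdry.comp (by fun_prop)
      · exact continuous_bdry.comp (by fun_prop))
    (by
      rintro (k | k)
      · exact continuous_bdry.comp (by fun_prop)
      · exact continuous_bdry.comp (by fun_prop))
  have hc : coboundary (F := Unit) (E := Fin g ⊕ Fin g) (fun _ => ()) (fun _ => ()) = 0 := by
    ext c e; simp [coboundary]
  rw [jumps_polygon, hc, LinearMap.range_zero, finrank_bot, finrank_top,
    finrank_fintype_fun_eq_card, Fintype.card_sum, Fintype.card_fin] at h
  omega

theorem connectedSpace_polygon {X : Type*} [TopologicalSpace X] {g : ℕ}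
    (Φ : PolygonSurface g ≃ₜ X) : ConnectedSpace X :=
  Function.Surjective.connectedSpace (f := (polygonGluing Φ).p ())
    (fun x => by obtain ⟨_, z, h⟩ := (polygonGluing Φ).p_surjective x; exact ⟨z, h⟩)
    ((polygonGluing Φ).p ()).continuous

/-! ### Glued sheets -/

section Sheets

variable {n d : ℕ} {δ : Fin n → ℕ} {X : Type*} [TopologicalSpace X]

/-- The glued sheets as a space glued from discs. -/
def sheetGluing (Φ : GluedSheets n d δ ≃ₜ X) :
    Gluing X (F := ZMod d) (E := Fin n × ZMod d) (fun e => e.2) (fun e => e.2 + (δ e.1 : ZMod d))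
      (fun e => leftSide n e.1) (fun e => rightSide n e.1) where
  p j := ⟨fun z => Φ (Quot.mk _ ⟨j, z⟩),
    Φ.continuous.comp (continuous_quot_mk.comp continuous_sigmaMk)⟩
  p_glue e r := congrArg Φ (Quot.sound (.glue e.2 e.1 r))
  exists_desc G hG := by
    refine ⟨⟨fun x => Quot.lift (fun y : Σ _ : ZMod d, Disc => G y.1 y.2) ?_ (Φ.symm x), ?_⟩,
      fun j z => ?_⟩
    · rintro _ _ ⟨j, i, r⟩
      exact hG (i, j) r
    · exact (continuous_quot_lift _ (continuous_sigma fun j => (G j).continuous)).comp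
        Φ.symm.continuous
    · exact congrArg (Quot.lift (fun y : Σ _ : ZMod d, Disc => G y.1 y.2) _)
        (Φ.symm_apply_apply _)
  p_surjective x := by
    obtain ⟨⟨j, z⟩, hz⟩ := Quot.exists_rep (Φ.symm x)
    exact ⟨j, z, by simp [hz]⟩

/-- The sheet number modulo the generated subgroup is unchanged by the gluing, so it is a continuous
map from `X` to a discrete space and must be constant. -/
theorem closure_range_eq_top [PreconnectedSpace X] (Φ : GluedSheets n d δ ≃ₜ X) :
    AddSubgroup.closure (Set.range fun i => (δ i : ZMod d)) = ⊤ := by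
  set H := AddSubgroup.closure (Set.range fun i => (δ i : ZMod d)) with hH
  let _ : TopologicalSpace (ZMod d ⧸ H) := ⊥
  have : DiscreteTopology (ZMod d ⧸ H) := ⟨rfl⟩
  obtain ⟨h, hh⟩ := (sheetGluing Φ).exists_desc
    (fun j => ContinuousMap.const Disc (QuotientAddGroup.mk j : ZMod d ⧸ H)) (by
      intro e r
      simp only [ContinuousMap.const_apply]
      rw [QuotientAddGroup.mk_add_of_mem]
      exact AddSubgroup.subset_closure ⟨e.1, rfl⟩)
  rw [eq_top_iff]
  rintro j -
  let z : Disc := ⟨0, by simp⟩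
  have h1 := PreconnectedSpace.constant ‹_› h.continuous
    (x := (sheetGluing Φ).p 0 z) (y := (sheetGluing Φ).p j z)
  rw [hh, hh, ContinuousMap.const_apply, ContinuousMap.const_apply, QuotientAddGroup.eq] at h1
  simpa using h1

theorem continuous_leftSide (i : Fin n) : Continuous (leftSide n i) :=
  continuous_bdry.comp (by fun_prop)

theorem continuous_rightSide (i : Fin n) : Continuous (rightSide n i) :=
  continuous_bdry.comp (by fun_prop)

theorem floor_sub_floor {x y : ℝ} {m : ℤ} (h : x - y = m) : m = ⌊x⌋ - ⌊y⌋ := by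
  rw [show x = y + m by linarith, Int.floor_add_intCast]; ring

/-- Jumps are constant along an arc, so only its two endpoints matter: integer corner values come
from the floors of real ones, and conversely corner values with the right differences interpolate
linearly along the sides. -/
theorem map_jumps_sheets (hsum : ∑ i, (δ i : ZMod d) = 0) :
    (jumps (F := ZMod d) (E := Fin n × ZMod d) (fun e => e.2) (fun e => e.2 + (δ e.1 : ZMod d))
      (fun e => leftSide n e.1) (fun e => rightSide n e.1)).map
        (LinearEquiv.curry ℤ ℤ (Fin n) (ZMod d)).toLinearMap =
      closedJumps fun i => (δ i : ZMod d) := by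
  ext m
  rw [mem_closedJumps_iff hsum, Submodule.mem_map]
  constructor
  · rintro ⟨m, ⟨G, hG⟩, rfl⟩
    rcases Nat.eq_zero_or_pos n with rfl | hn
    · exact ⟨0, 0, rfl, fun i => i.elim0, fun i => i.elim0⟩
    have hn' : (n : ℝ) ≠ 0 := by positivity
    refine ⟨fun i j => ⌊G j (leftSide n i 1)⌋, fun k j => ⌊G j (bdry (k / n))⌋, ?_, ?_, ?_⟩
    · ext j
      dsimp only
      congr 2
      rw [bdry_eq_iff]
      exact ⟨1, by simp [hn']⟩
    · intro i j
      refine floor_sub_floor ?_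
      have h := hG (i, j) 1
      have : rightSide n i 1 = leftSide n i 1 := by
        simp only [rightSide, leftSide, Set.Icc.coe_one]
        congr 2; ring
      refine Eq.trans ?_ h
      exact congrArg (fun y => G j (leftSide n i 1) - G (j + δ i) y) this.symm
    · intro i j
      refine floor_sub_floor ?_
      have h := hG (i, j) 0
      have h1 : leftSide n i 0 = bdry ((i : ℕ) / n) := by
        simp only [leftSide, Set.Icc.coe_zero]
        congr 1
        rw [add_zero, mul_div_mul_left _ _ two_ne_zero]
      have h2 : rightSide n i 0 = bdry (((i : ℕ) + 1 : ℕ) / n) := by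
        simp only [rightSide, Set.Icc.coe_zero]
        congr 1
        rw [sub_zero, show 2 * ((i : ℕ) : ℝ) + 2 = 2 * ((i : ℕ) + 1) by ring,
          mul_div_mul_left _ _ two_ne_zero, Nat.cast_add_one]
      rw [← h1, ← h2]
      exact h
  · rintro ⟨v, w, hw, hv, hm⟩
    refine ⟨fun e => m e.1 e.2, ?_, rfl⟩
    rcases Nat.eq_zero_or_pos n with rfl | hn
    · exact ⟨0, fun e => e.1.elim0⟩
    let v' : ℕ → ZMod d → ℝ := fun k j => if h : k < n then v ⟨k, h⟩ j else 0
    -- Even corners of the 2n-gon lie over the base point, odd corners over the tips of the cuts.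
    let c : ZMod d → ℕ → ℝ := fun j l => if l % 2 = 0 then w (l / 2) j else v' (l / 2) j
    have c0 : ∀ j k, c j (2 * k) = w k j := fun j k => by simp [c]
    have c1 : ∀ j k, c j (2 * k + 1) = v' k j := fun j k => by
      simp [c, Nat.add_mod, (by omega : (2 * k + 1) / 2 = k)]
    have c2 : ∀ j k, c j (2 * k + 1 + 1) = w (k + 1) j := fun j k => c0 j (k + 1)
    choose G hG using fun j => exists_disc_function (N := 2 * n) (by omega) (c j)
      (by rw [c0, hw, ← c0 j 0])
    refine ⟨G, fun e r => ?_⟩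
    obtain ⟨i, j⟩ := e
    have hs : ((unitInterval.symm r : unitInterval) : ℝ) = 1 - r := rfl
    have h1 := hG j (2 * i) (by omega) r
    have h2 := hG (j + δ i) (2 * i + 1) (by omega) (unitInterval.symm r)
    rw [c0, c1] at h1
    rw [c1, c2, hs] at h2
    push_cast at h1 h2
    rw [show (2 * ((i : ℕ) : ℝ) + 1 + (1 - r)) = 2 * (i : ℕ) + 2 - r by ring] at h2
    simp only [leftSide, rightSide]
    rw [h1, h2]
    have e1 : ((m i j : ℤ) : ℝ) = v i j - v i (j + δ i) := by exact_mod_cast hv i j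
    have e2 : ((m i j : ℤ) : ℝ) = w i j - w (i + 1) (j + δ i) := by exact_mod_cast hm i j
    simp only [v', i.2, dif_pos, Fin.eta]
    -- The jump at parameter `r` interpolates the jump at the tip (weight `r`) and at the base point
    -- (weight `1 - r`), which are equal.
    linear_combination (-(r : ℝ)) * e1 - (1 - (r : ℝ)) * e2

/-- Realizable jumps have rank nd - (d - 1) - ∑ gcd(d, δ i), and coboundaries have rank d - 1. -/
theorem finrank_circleCohomology_sheets [NeZero d] [PreconnectedSpace X]
    (Φ : GluedSheets n d δ ≃ₜ X) (hd : d ∣ ∑ i, δ i) :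
    finrank ℤ (CircleCohomology X) + ∑ i, d.gcd (δ i) + 2 * d = n * d + 2 := by
  have h := (sheetGluing Φ).finrank_circleCohomology (fun e => continuous_leftSide e.1)
    fun e => continuous_rightSide e.1
  have hsum : ∑ i, (δ i : ZMod d) = 0 := by
    rw [← Nat.cast_sum, ZMod.natCast_eq_zero_iff]; exact hd
  have htop := closure_range_eq_top Φ
  have h1 := finrank_closedJumps htop
  have h2 := finrank_range_sheetCoboundary htop
  have e1 : (LinearMap.range (coboundary (F := ZMod d) (E := Fin n × ZMod d) (fun e => e.2)
      fun e => e.2 + (δ e.1 : ZMod d))).map (LinearEquiv.curry ℤ ℤ (Fin n) (ZMod d)).toLinearMap =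
      LinearMap.range (sheetCoboundary fun i => (δ i : ZMod d)) := by
    rw [← LinearMap.range_comp]
    rfl
  rw [← map_jumps_sheets hsum, LinearEquiv.finrank_map_eq, ZMod.card] at h1
  rw [← e1, LinearEquiv.finrank_map_eq, ZMod.card] at h2
  simp only [index_closure_singleton] at h1
  omega

end Sheets

/-! ### Covers with equal degree and branching indices are equivalent -/

theorem exists_side {n : ℕ} (hn : 0 < n) {z : Disc} (hz : ‖(z : ℂ)‖ = 1) :
    ∃ (i : Fin n) (t : unitInterval), z = leftSide n i t ∨ z = rightSide n i t := by
  obtain ⟨x, h0, h1, rfl⟩ := exists_bdry_eq hz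
  have hn' : (0 : ℝ) < 2 * n := by positivity
  -- The number of the side containing the point: even for left sides, odd for right sides, which
  -- are parametrized backwards.
  set l := ⌊2 * n * x⌋₊ with hl
  have hl0 : (l : ℝ) ≤ 2 * n * x := Nat.floor_le (by positivity)
  have hl1 : 2 * n * x < l + 1 := Nat.lt_floor_add_one _
  have hln : l < 2 * n := by
    have : (l : ℝ) < 2 * n := by nlinarith
    exact_mod_cast this
  rcases Nat.even_or_odd' l with ⟨i, hi | hi⟩
  · have hc : (l : ℝ) = 2 * i := by exact_mod_cast hi
    refine ⟨⟨i, by omega⟩, ⟨2 * n * x - l, by linarith, by linarith⟩, .inl ?_⟩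
    rw [leftSide]
    congr 1
    rw [eq_div_iff hn'.ne']
    simp only [hc]
    ring
  · have hc : (l : ℝ) = 2 * i + 1 := by exact_mod_cast hi
    refine ⟨⟨i, by omega⟩, ⟨1 - (2 * n * x - l), by linarith, by linarith⟩, .inr ?_⟩
    rw [rightSide]
    congr 1
    rw [eq_div_iff hn'.ne']
    simp only [hc]
    ring

namespace CutSphere

variable {n : ℕ}

theorem norm_lt_or_exists_side (hn : 0 < n) (z : Disc) :
    ‖(z : ℂ)‖ < 1 ∨ ∃ (i : Fin n) (t : unitInterval), ∀ Y : CutSphere n, Y.unfold z = Y.γ i t := by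
  rcases (mem_closedBall_zero_iff.1 z.2).lt_or_eq with h | h
  · exact .inl h
  · obtain ⟨i, t, rfl | rfl⟩ := exists_side hn h
    · exact .inr ⟨i, t, fun Y => Y.unfold_left i t⟩
    · exact .inr ⟨i, t, fun Y => Y.unfold_right i t⟩

theorem unfold_ne_γ (Y : CutSphere n) {z : Disc} (hz : ‖(z : ℂ)‖ < 1) (i : Fin n)
    (t : unitInterval) : Y.unfold z ≠ Y.γ i t := by
  intro h
  have := Set.mem_image_of_mem Y.unfold (show z ∈ {z : Disc | ‖(z : ℂ)‖ < 1} from hz)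
  rw [Y.unfold_image, h] at this
  exact this (Set.mem_iUnion.2 ⟨i, t, rfl⟩)

/-- Interior points are identified with nothing else, and boundary points are identified according
to their cut and parameter alone, all base corners becoming one point. This pattern is the same for
every cut sphere. -/
theorem unfold_eq_of_unfold_eq (hn : 0 < n) (Y Y' : CutSphere n) {z z' : Disc}
    (h : Y.unfold z = Y.unfold z') : Y'.unfold z = Y'.unfold z' := by
  rcases norm_lt_or_exists_side hn z with hz | ⟨i, t, hz⟩ <;>
    rcases norm_lt_or_exists_side hn z' with hz' | ⟨k, t', hz'⟩
  · rw [Y.unfold_injOn hz hz' h]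
  · exact absurd (h.trans (hz' Y)) (Y.unfold_ne_γ hz k t')
  · exact absurd (h.symm.trans (hz Y)) (Y.unfold_ne_γ hz' i t)
  · rw [hz, hz'] at h ⊢
    rcases eq_or_ne i k with rfl | hik
    · rw [Y.γ_injective i h]
    · obtain ⟨rfl, rfl⟩ := Y.γ_disjoint i k t t' hik h
      rw [Y'.γ_zero, Y'.γ_zero]

theorem unfold_surjective (Y : CutSphere n) : Function.Surjective Y.unfold := by
  intro x
  by_cases hx : x ∈ ⋃ i, Set.range (Y.γ i)
  · obtain ⟨i, t, rfl⟩ := Set.mem_iUnion.1 hx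
    exact ⟨_, Y.unfold_left i t⟩
  · have : x ∈ (⋃ i, Set.range (Y.γ i))ᶜ := hx
    rw [← Y.unfold_image] at this
    obtain ⟨z, -, hz⟩ := this
    exact ⟨z, hz⟩

theorem isQuotientMap_unfold (Y : CutSphere n) : Topology.IsQuotientMap Y.unfold :=
  .of_surjective_continuous Y.unfold_surjective Y.unfold.continuous

/-- Any two cut spheres are homeomorphic, compatibly with the identifications with the polygon. -/
theorem exists_homeomorph (hn : 0 < n) (Y Y' : CutSphere n) :
    ∃ ψ : S2 ≃ₜ S2, ∀ z, ψ (Y.unfold z) = Y'.unfold z := by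
  have key : ∀ Y Y' : CutSphere n, ∃ f : C(S2, S2), ∀ z, f (Y.unfold z) = Y'.unfold z :=
    fun Y Y' =>
      have h : Function.FactorsThrough Y'.unfold Y.unfold :=
        fun _ _ h => unfold_eq_of_unfold_eq hn Y Y' h
      ⟨Y.isQuotientMap_unfold.lift Y'.unfold h, fun z =>
        DFunLike.congr_fun (Y.isQuotientMap_unfold.lift_comp Y'.unfold h) z⟩
  obtain ⟨f, hf⟩ := key Y Y'
  obtain ⟨f', hf'⟩ := key Y' Y
  refine ⟨⟨⟨f, f', fun x => ?_, fun x => ?_⟩, f.continuous, f'.continuous⟩, hf⟩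
  · obtain ⟨z, rfl⟩ := Y.unfold_surjective x
    rw [hf, hf']
  · obtain ⟨z, rfl⟩ := Y'.unfold_surjective x
    rw [hf', hf]

end CutSphere

theorem IsCyclicallyBranchedCover.exists_equivalence {n d : ℕ} {δ : Fin n → ℕ} (hn : 0 < n)
    {X X' : Type*} [TopologicalSpace X] [TopologicalSpace X'] {π : X → S2} {π' : X' → S2}
    (h : IsCyclicallyBranchedCover n d δ π) (h' : IsCyclicallyBranchedCover n d δ π') :
    ∃ (Ψ : X ≃ₜ X') (ψ : S2 ≃ₜ S2), ∀ x, π' (Ψ x) = ψ (π x) := by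
  obtain ⟨Y, Φ, hΦ⟩ := h.exists_gluing
  obtain ⟨Y', Φ', hΦ'⟩ := h'.exists_gluing
  obtain ⟨ψ, hψ⟩ := CutSphere.exists_homeomorph hn Y Y'
  refine ⟨Φ.symm.trans Φ', ψ, fun x => ?_⟩
  obtain ⟨y, rfl⟩ := Φ.surjective x
  rw [Homeomorph.trans_apply, Homeomorph.symm_apply_apply]
  obtain ⟨⟨j, z⟩, rfl⟩ := Quot.exists_rep y
  exact (hΦ' j z).trans ((hψ z).symm.trans (congrArg ψ (hΦ j z).symm))

/-- The Riemann-Hurwitz formula for cyclically branched covers. -/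
theorem riemann_hurwitz {n d g : ℕ} {δ : Fin n → ℕ} (hn : 0 < n) (hg : 1 ≤ g) {X : Type*}
    [TopologicalSpace X] {π : X → S2} (h : IsCyclicallyBranchedCover n d δ π)
    (hX : HasGenus X g) : 2 * g + ∑ i, d.gcd (δ i) + 2 * d = n * d + 2 := by
  -- Positive genus selects the polygon model in `HasGenus`; connectedness of `X` also comes from
  -- that model.
  obtain ⟨g, rfl⟩ : ∃ k, g = k + 1 := ⟨g - 1, by omega⟩
  obtain ⟨Θ⟩ := hX
  have : ConnectedSpace X := connectedSpace_polygon Θ.symm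
  have : NeZero d := ⟨by have := h.index_lt ⟨0, hn⟩; omega⟩
  obtain ⟨-, Φ, -⟩ := h.exists_gluing
  rw [← finrank_circleCohomology_polygon Θ.symm]
  exact finrank_circleCohomology_sheets Φ h.dvd_sum

/-! ### Bounds and finiteness for covers of given genus -/

theorem Cover.degree_bounds {n g : ℕ} (hn : 3 ≤ n) (hg : 2 ≤ g) (C : Cover.{u} n)
    (hC : HasGenus C.X g) :
    (n = 3 → (C.d : ℝ) ≤ 84 * ((g : ℝ) - 1)) ∧
    (n = 4 → (C.d : ℝ) ≤ 12 * ((g : ℝ) - 1)) ∧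
    (5 ≤ n → 2 * (g : ℝ) / ((n : ℝ) - 2) + 1 ≤ (C.d : ℝ) ∧
      (C.d : ℝ) ≤ 4 * ((g : ℝ) - 1) / ((n : ℝ) - 4)) :=
  CyclicCover.degree_bounds hn hg C.isCover.index_pos C.isCover.index_lt
    (riemann_hurwitz (by omega) (by omega) C.isCover hC)

/-- A crude bound, uniform in `n`, which suffices for finiteness. -/
theorem Cover.degree_le {n g : ℕ} (hn : 3 ≤ n) (hg : 2 ≤ g) (C : Cover.{u} n)
    (hC : HasGenus C.X g) : C.d ≤ 84 * g := by
  obtain ⟨h3, h4, h5⟩ := C.degree_bounds hn hg hC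
  have hgR : (2 : ℝ) ≤ g := by exact_mod_cast hg
  suffices (C.d : ℝ) ≤ 84 * g by exact_mod_cast this
  rcases (by omega : n = 3 ∨ n = 4 ∨ 5 ≤ n) with h | h | h
  · linarith [h3 h]
  · linarith [h4 h]
  · have hnR : (5 : ℝ) ≤ n := by exact_mod_cast h
    have : 4 * ((g : ℝ) - 1) / ((n : ℝ) - 4) ≤ 4 * ((g : ℝ) - 1) :=
      div_le_self (by linarith) (by linarith)
    linarith [(h5 h).2]

theorem finite_degree_indices {n g : ℕ} (hn : 3 ≤ n) (hg : 2 ≤ g) :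
    {D : ℕ × (Fin n → ℕ) | ∃ C : Cover.{u} n,
      HasGenus C.X g ∧ C.d = D.1 ∧ C.δ = D.2}.Finite := by
  refine ((Set.finite_Iic (84 * g)).prod
    (Set.finite_Icc (0 : Fin n → ℕ) fun _ => 84 * g)).subset ?_
  rintro ⟨d, δ⟩ ⟨C, hC, rfl, rfl⟩
  have hd := C.degree_le hn hg hC
  exact ⟨hd, zero_le, fun i => (C.isCover.index_lt i).le.trans hd⟩

end CyclicCover

theorem mainTheorem1 (n g : ℕ) (hn : 3 ≤ n) (hg : 2 ≤ g) :
    -- finitely many covers of genus `g`, up to equivalence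
    (∃ S : Set (CyclicCover.Cover.{u} n), S.Finite ∧
      (∀ C ∈ S, CyclicCover.HasGenus C.X g) ∧
      ∀ C : CyclicCover.Cover.{u} n, CyclicCover.HasGenus C.X g →
        ∃ C' ∈ S, C'.d = C.d ∧ C'.δ = C.δ ∧ C.Equivalent C') ∧
    -- finitely many possible degrees and branching indices
    {D : ℕ × (Fin n → ℕ) | ∃ C : CyclicCover.Cover.{u} n,
      CyclicCover.HasGenus C.X g ∧ C.d = D.1 ∧ C.δ = D.2}.Finite ∧
    -- the bounds on the degree
    ∀ C : CyclicCover.Cover.{u} n, CyclicCover.HasGenus C.X g →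
      (n = 3 → (C.d : ℝ) ≤ 84 * ((g : ℝ) - 1)) ∧
      (n = 4 → (C.d : ℝ) ≤ 12 * ((g : ℝ) - 1)) ∧
      (5 ≤ n → 2 * (g : ℝ) / ((n : ℝ) - 2) + 1 ≤ (C.d : ℝ) ∧
        (C.d : ℝ) ≤ 4 * ((g : ℝ) - 1) / ((n : ℝ) - 4)) := by
  have hfin := CyclicCover.finite_degree_indices.{u} hn hg
  refine ⟨?_, hfin, fun C hC => C.degree_bounds hn hg hC⟩
  -- `S` contains exactly one cover of genus `g` for each degree and branching indices that occur.
  obtain ⟨S, hS, hbij⟩ := Set.exists_subset_bijOn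
    {C : CyclicCover.Cover.{u} n | CyclicCover.HasGenus C.X g} fun C => (C.d, C.δ)
  refine ⟨S, .of_finite_image (hfin.subset ?_) hbij.injOn, hS, fun C hC => ?_⟩
  · rintro _ ⟨C, hC, rfl⟩
    exact ⟨C, hS hC, rfl, rfl⟩
  · obtain ⟨C', hC', h⟩ := hbij.surjOn ⟨C, hC, rfl⟩
    obtain ⟨h1, h2⟩ := Prod.mk.inj h
    refine ⟨C', hC', h1, h2, ?_⟩
    have h' := C'.isCover
    rw [h1, h2] at h'
    exact C.isCover.exists_equivalence (by omega) h'
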